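/- Let $\sigma$ be the substitution on the alphabet $\{a,b,c\}$ given by $\sigma(a)=ab$, $\sigma(b)=ac$, $\sigma(c)=a$, and let $\mathbb{T}$ be the Tribonacci sequence, that is, the infinite fixed point of $\sigma$ beginning with $a$. Put $T_m=\sigma^m(a)$ for $m\ge 0$, $T_{-1}=c$, let $T_{-2}$ be the empty word, and let $t_m=|T_m|$ be the length of $T_m$ for $m\ge -2$ (so $t_{-2}=0$, $t_{-1}=t_0=1$ and $t_m=t_{m-1}+t_{m-2}+t_{m-3}$ for $m\ge 1$). A cube is a word of the form $\omega\omega\omega$ with $\omega$ a nonempty finite word. For $n\ge 0$ let $B(n)$ be the number of distinct cubes (distinct as words) that occur as factors, i.e. as contiguous subwords, of the prefix $\mathbb{T}[1,n]$ of length $n$ of $\mathbb{T}$; for $m\ge 0$ the prefix $\mathbb{T}[1,t_m]$ is $T_m$, so $B(t_m)$ is then the number of distinct cubes in $T_m$. Then, for every integer $m$ with $-2\le m\le 6$, $$B(t_m)=0,$$ and, for every integer $m\ge 7$, $$B(t_m)=\frac{t_{m-5}+t_{m-6}-m+3}{2}.$$ -/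

import Mathlib

namespace Tribonacci

/-- The three-letter alphabet `{a, b, c}`. -/
inductive Letter where
  | a : Letter
  | b : Letter
  | c : Letter

/-- The substitution on letters: `a ↦ ab`, `b ↦ ac`, `c ↦ a`. -/
def sigma : Letter → List Letter
  | Letter.a => [Letter.a, Letter.b]
  | Letter.b => [Letter.a, Letter.c]
  | Letter.c => [Letter.a]

/-- The substitution extended to finite words by concatenation. -/
def sigmaWord (w : List Letter) : List Letter := w.flatMap sigma

/-- The words `T_m`, used for `m ≥ -2`: `T_m = σ^m(a)` for `m ≥ 0`, `T_{-1} = c`, and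
`T_{-2}` is the empty word (as is, by convention, `T_m` for `m < -2`). -/
def word : ℤ → List Letter
  | Int.ofNat m => sigmaWord^[m] [Letter.a]
  | Int.negSucc 0 => [Letter.c]
  | Int.negSucc (_ + 1) => []

/-- The Tribonacci numbers `t_m = |T_m|`. -/
def t (m : ℤ) : ℕ := (word m).length

/-- The Tribonacci sequence, the fixed point of the substitution that begins with `a`, indexed
from `0`. The word `T_i` is a prefix of it and has length greater than `i`, so that the default
value is never used (see `lt_length_word`, `seq_zero`, `sigmaWord_prefixWord`). -/
def seq (i : ℕ) : Letter := (word i).getD i Letter.a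

/-- The prefix of length `n` of the Tribonacci sequence. -/
def prefixWord (n : ℕ) : List Letter := (List.range n).map seq

/-- A cube is a word `www` with `w` nonempty. -/
def IsCube (u : List Letter) : Prop := ∃ w : List Letter, w ≠ [] ∧ u = w ++ w ++ w

/-- The set of the (distinct) cubes that are factors (contiguous subwords) of `v`. -/
def cubesIn (v : List Letter) : Set (List Letter) := {u | IsCube u ∧ u <:+: v}

/-- `B n` is the number of distinct cubes in the prefix of length `n` of the Tribonacci
sequence. -/
noncomputable def B (n : ℕ) : ℕ := (cubesIn (prefixWord n)).ncard

theorem cubesIn_finite (v : List Letter) : (cubesIn v).Finite := by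
  refine (List.finite_toSet v.sublists).subset ?_
  rintro u ⟨-, hu⟩
  exact List.mem_sublists.2 hu.sublist

theorem sigmaWord_append (u v : List Letter) :
    sigmaWord (u ++ v) = sigmaWord u ++ sigmaWord v := by
  simp [sigmaWord]

theorem sigmaWord_isPrefix {u v : List Letter} (h : u <+: v) : sigmaWord u <+: sigmaWord v := by
  obtain ⟨r, rfl⟩ := h
  exact ⟨sigmaWord r, (sigmaWord_append u r).symm⟩

theorem length_le_sigmaWord (w : List Letter) : w.length ≤ (sigmaWord w).length := by
  induction w with
  | nil => simp
  | cons x w ih =>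
    have h : sigmaWord (x :: w) = sigma x ++ sigmaWord w := by simp [sigmaWord]
    rw [h]
    cases x <;> simp [sigma] <;> omega

theorem word_succ (m : ℕ) : word ((m + 1 : ℕ) : ℤ) = sigmaWord (word (m : ℤ)) :=
  Function.iterate_succ_apply' sigmaWord m [Letter.a]

theorem word_isPrefix_succ (m : ℕ) : word (m : ℤ) <+: word ((m + 1 : ℕ) : ℤ) := by
  induction m with
  | zero => exact ⟨[Letter.b], rfl⟩
  | succ m ih =>
    rw [word_succ (m + 1), word_succ m]
    rw [word_succ m] at ih
    exact sigmaWord_isPrefix ih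

theorem word_isPrefix {m n : ℕ} (h : m ≤ n) : word (m : ℤ) <+: word (n : ℤ) := by
  induction n, h using Nat.le_induction with
  | base => exact List.prefix_rfl
  | succ n _ ih => exact ih.trans (word_isPrefix_succ n)

theorem word_head (m : ℕ) : ∃ w, word (m : ℤ) = Letter.a :: w := by
  obtain ⟨r, hr⟩ := word_isPrefix (Nat.zero_le m)
  exact ⟨r, hr.symm⟩

theorem lt_length_word (m : ℕ) : m < (word (m : ℤ)).length := by
  induction m with
  | zero => exact Nat.zero_lt_one
  | succ m ih =>
    rw [word_succ]
    obtain ⟨w, hw⟩ := word_head m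
    rw [hw] at ih ⊢
    have h : sigmaWord (Letter.a :: w) = [Letter.a, Letter.b] ++ sigmaWord w := by
      simp [sigmaWord, sigma]
    have := length_le_sigmaWord w
    rw [h]
    simp at ih ⊢
    omega

theorem getElem_word (m i : ℕ) (h : i < (word (m : ℤ)).length) :
    (word (m : ℤ))[i] = seq i := by
  have hi := lt_length_word i
  have key : (word (i : ℤ))[i] = (word (m : ℤ))[i] := by
    rcases le_total i m with h1 | h1
    · exact (word_isPrefix h1).getElem hi
    · exact ((word_isPrefix h1).getElem h).symm
  rw [← key, seq, List.getD_eq_getElem _ _ hi]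

/-- For `m ≥ 0`, the word `T_m` is the prefix of length `t_m` of the Tribonacci sequence. -/
theorem prefixWord_t (m : ℕ) : prefixWord (t m) = word (m : ℤ) := by
  apply List.ext_getElem
  · simp [prefixWord, t]
  · intro i h1 h2
    rw [getElem_word m i h2]
    simp [prefixWord]

/-- The Tribonacci sequence begins with `a`. -/
theorem seq_zero : seq 0 = Letter.a := rfl

theorem prefixWord_isPrefix {m n : ℕ} (h : m ≤ n) : prefixWord m <+: prefixWord n := by
  obtain ⟨k, rfl⟩ := Nat.exists_eq_add_of_le h
  simp [prefixWord, List.range_add]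

/-- The Tribonacci sequence is fixed by the substitution: the image of each of its prefixes is
again one of its prefixes. -/
theorem sigmaWord_prefixWord (n : ℕ) :
    sigmaWord (prefixWord n) = prefixWord (sigmaWord (prefixWord n)).length := by
  have h1 : prefixWord n <+: word (n : ℤ) := by
    rw [← prefixWord_t]
    exact prefixWord_isPrefix (lt_length_word n).le
  have h2 := sigmaWord_isPrefix h1
  rw [← word_succ, ← prefixWord_t] at h2
  have h3 : prefixWord (sigmaWord (prefixWord n)).length <+: prefixWord (t ((n + 1 : ℕ) : ℤ)) := by
    apply prefixWord_isPrefix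
    simpa [prefixWord] using h2.length_le
  exact (List.prefix_of_prefix_length_le h2 h3 (by simp [prefixWord])).eq_of_length
    (by simp [prefixWord])

end Tribonacci

/-! Every block σ(x) begins with `a`, and the letter after that `a` determines x. So σ can be
undone, and the images of equal windows still agree one letter further (`Agree.phi`). Iterating this
k times from an occurrence of `aa` gives a run of period t_k and length 2 t_k + (t_0 + ... +
t_{k-1}).

Conversely, a repetition of period p and length at least 3p - 1 desubstitutes down to period 1,
where only `aa` is possible; hence it lies in such a run (`exists_run_of_period`). All runs of level
k are the same word (`IsDouble.agree`). The first one, from the `aa` at position 6, ends inside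
T_{k+4} (`run_end_le`), and no cube of period t_k occurs in a shorter T_m. The run contributes t_0 +
... + t_{k-1} + 1 - t_k cubes, pairwise distinct (`window_injOn_run`); summing over k ≤ m - 4 gives
the formula. -/

namespace Tribonacci

/-! ### Block structure of the fixed point -/

/-- The length of the image of the prefix of length `n` under the substitution. -/
def phi (n : ℕ) : ℕ := (sigmaWord (prefixWord n)).length

/-- The Tribonacci numbers with natural index. -/
def trib (k : ℕ) : ℕ := t (k : ℤ)

theorem prefixWord_length (n : ℕ) : (prefixWord n).length = n := by simp [prefixWord]

theorem prefixWord_succ (n : ℕ) : prefixWord (n + 1) = prefixWord n ++ [seq n] := by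
  simp [prefixWord, List.range_succ]

theorem phi_zero : phi 0 = 0 := rfl

theorem phi_succ (n : ℕ) : phi (n + 1) = phi n + (sigma (seq n)).length := by
  simp [phi, prefixWord_succ, sigmaWord]

theorem prefixWord_phi (n : ℕ) : prefixWord (phi n) = sigmaWord (prefixWord n) :=
  (sigmaWord_prefixWord n).symm

theorem prefixWord_phi_succ (n : ℕ) :
    prefixWord (phi (n + 1)) = prefixWord (phi n) ++ sigma (seq n) := by
  rw [prefixWord_phi, prefixWord_phi, prefixWord_succ, sigmaWord_append]
  simp [sigmaWord]

theorem seq_phi_add (n x : ℕ) (h : x < (sigma (seq n)).length) :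
    seq (phi n + x) = (sigma (seq n))[x] := by
  have h1 : phi n + x < (prefixWord (phi (n + 1))).length := by
    rw [prefixWord_length, phi_succ]; omega
  have h2 : (prefixWord (phi (n + 1)))[phi n + x] = seq (phi n + x) := by simp [prefixWord]
  rw [← h2]
  simp only [prefixWord_phi_succ]
  rw [List.getElem_append_right (by simp [prefixWord_length])]
  simp [prefixWord_length]

theorem seq_phi (n : ℕ) : seq (phi n) = Letter.a := by
  have h := seq_phi_add n 0 (by cases seq n <;> simp [sigma])
  rw [Nat.add_zero] at h
  rw [h]
  cases seq n <;> rfl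

/-- The second letter of the image of `x` followed by the image of any letter. -/
def sndLetter : Letter → Letter
  | Letter.a => Letter.b
  | Letter.b => Letter.c
  | Letter.c => Letter.a

theorem sndLetter_injective : Function.Injective sndLetter := by
  intro x y h
  cases x <;> cases y <;> simp_all [sndLetter]

theorem phi_succ_of_eq_c {n : ℕ} (h : seq n = Letter.c) : phi (n + 1) = phi n + 1 := by
  rw [phi_succ, h]; rfl

theorem phi_succ_of_ne_c {n : ℕ} (h : seq n ≠ Letter.c) : phi (n + 1) = phi n + 2 := by
  rw [phi_succ]
  cases hs : seq n <;> simp_all [sigma]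

theorem seq_phi_add_one (n : ℕ) : seq (phi n + 1) = sndLetter (seq n) := by
  cases hs : seq n with
  | a => rw [seq_phi_add n 1 (by simp [hs, sigma])]; simp [hs, sigma, sndLetter]
  | b => rw [seq_phi_add n 1 (by simp [hs, sigma])]; simp [hs, sigma, sndLetter]
  | c => rw [← phi_succ_of_eq_c hs, seq_phi]; rfl

theorem phi_succ_bounds (n : ℕ) : phi n + 1 ≤ phi (n + 1) ∧ phi (n + 1) ≤ phi n + 2 := by
  by_cases h : seq n = Letter.c
  · rw [phi_succ_of_eq_c h]; omega
  · rw [phi_succ_of_ne_c h]; omega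

theorem phi_strictMono : StrictMono phi :=
  strictMono_nat_of_lt_succ fun n => (phi_succ_bounds n).1

theorem exists_phi_eq (x : ℕ) :
    ∃ n, x = phi n ∨ (x = phi n + 1 ∧ phi (n + 1) = phi n + 2) := by
  induction x with
  | zero => exact ⟨0, Or.inl rfl⟩
  | succ x ih =>
    obtain ⟨n, rfl | ⟨rfl, h⟩⟩ := ih
    · by_cases hc : seq n = Letter.c
      · exact ⟨n + 1, Or.inl (phi_succ_of_eq_c hc).symm⟩
      · exact ⟨n, Or.inr ⟨rfl, phi_succ_of_ne_c hc⟩⟩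
    · exact ⟨n + 1, Or.inl h.symm⟩

theorem exists_phi_eq_of_seq_eq_a {x : ℕ} (h : seq x = Letter.a) : ∃ n, x = phi n := by
  obtain ⟨n, hn | ⟨hn, h2⟩⟩ := exists_phi_eq x
  · exact ⟨n, hn⟩
  · rw [hn, seq_phi_add_one] at h
    have hc : seq n = Letter.c := sndLetter_injective (h.trans rfl)
    rw [phi_succ_of_eq_c hc] at h2
    omega

theorem exists_phi_add_one_eq_of_seq_ne_a {x : ℕ} (h : seq x ≠ Letter.a) :
    ∃ n, x = phi n + 1 ∧ phi (n + 1) = phi n + 2 := by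
  obtain ⟨n, hn | hn⟩ := exists_phi_eq x
  · exact absurd (hn ▸ seq_phi n) h
  · exact ⟨n, hn⟩

theorem seq_succ_of_ne_a {x : ℕ} (h : seq x ≠ Letter.a) : seq (x + 1) = Letter.a := by
  obtain ⟨n, rfl, h2⟩ := exists_phi_add_one_eq_of_seq_ne_a h
  rw [show phi n + 1 + 1 = phi (n + 1) by omega, seq_phi]

/-- A `c` is always followed by `a`, so two consecutive blocks are never both of length one. -/
theorem phi_add_two (n : ℕ) : phi n + 3 ≤ phi (n + 2) := by
  change phi n + 3 ≤ phi (n + 1 + 1)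
  have h1 := phi_succ_bounds n
  have h2 := phi_succ_bounds (n + 1)
  by_cases h : seq n = Letter.c
  · have h3 : seq (n + 1) ≠ Letter.c := by
      rw [seq_succ_of_ne_a (by simp [h])]; simp
    have := phi_succ_of_ne_c h3
    omega
  · have := phi_succ_of_ne_c h
    omega

/-- In `aa` the first letter is the whole block of a `c`; the next preimage letter is then `a`,
whose block is `ab`. -/
theorem not_seq_cube {x : ℕ} (h0 : seq x = Letter.a) (h1 : seq (x + 1) = Letter.a)
    (h2 : seq (x + 2) = Letter.a) : False := by
  obtain ⟨n, rfl⟩ := exists_phi_eq_of_seq_eq_a h0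
  rw [seq_phi_add_one] at h1
  have hc : seq n = Letter.c := sndLetter_injective (h1.trans rfl)
  rw [show phi n + 2 = phi (n + 1) + 1 by rw [phi_succ_of_eq_c hc], seq_phi_add_one,
    seq_succ_of_ne_a (by simp [hc])] at h2
  simp [sndLetter] at h2

/-! ### Tribonacci numbers -/

theorem trib_succ (k : ℕ) : trib (k + 1) = phi (trib k) := by
  rw [phi, trib, trib, prefixWord_t, ← word_succ, t]

theorem trib_zero : trib 0 = 1 := rfl

theorem word_add_three (k : ℕ) :
    word ((k + 3 : ℕ) : ℤ) = word ((k + 2 : ℕ) : ℤ) ++ word ((k + 1 : ℕ) : ℤ) ++ word (k : ℤ) := by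
  induction k with
  | zero => rfl
  | succ k ih =>
    have h := congrArg sigmaWord ih
    rwa [sigmaWord_append, sigmaWord_append, ← word_succ, ← word_succ, ← word_succ,
      ← word_succ] at h

theorem trib_add_three (k : ℕ) : trib (k + 3) = trib (k + 2) + trib (k + 1) + trib k := by
  simp only [trib, t, word_add_three, List.length_append]

theorem phi_le (n : ℕ) : phi n ≤ 2 * n := by
  induction n with
  | zero => simp [phi_zero]
  | succ n ih => have := phi_succ_bounds n; omega

theorem lt_phi {n : ℕ} (h : 0 < n) : n < phi n := by
  induction n, h using Nat.le_induction with
  | base => exact (show 1 < trib 1 by decide).trans_eq (trib_succ 0)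
  | succ n _ ih => have := phi_succ_bounds n; omega

theorem trib_pos (k : ℕ) : 0 < trib k := by
  induction k with
  | zero => simp [trib_zero]
  | succ k ih => rw [trib_succ]; exact (Nat.zero_le _).trans_lt (lt_phi ih)

theorem trib_strictMono : StrictMono trib :=
  strictMono_nat_of_lt_succ fun k => by rw [trib_succ]; exact lt_phi (trib_pos k)

theorem trib_succ_le (k : ℕ) : trib (k + 1) ≤ 2 * trib k := by
  rw [trib_succ]; exact phi_le _

/-! ### Agreement of windows under substitution -/

/-- The sequence agrees with itself on the windows of length `r` at `q` and `q'`. -/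
def Agree (q q' r : ℕ) : Prop := ∀ n < r, seq (q + n) = seq (q' + n)

theorem Agree.phi_add {q q' r : ℕ} (h : Agree q q' r) {n : ℕ} (hn : n ≤ r) :
    phi (q + n) + phi q' = phi (q' + n) + phi q := by
  induction n with
  | zero => simp [Nat.add_comm]
  | succ n ih =>
    have h1 := ih (by omega)
    rw [← Nat.add_assoc, ← Nat.add_assoc, phi_succ, phi_succ, h n (by omega)]
    omega

/-- The `+ 1` is the gain of one letter: whatever follows the two windows, its image begins with
`a`. -/
theorem Agree.phi {q q' r s : ℕ} (h : Agree q q' r) (hs : phi q + s ≤ phi (q + r) + 1) :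
    Agree (phi q) (phi q') s := by
  intro x hx
  obtain ⟨n, hn⟩ := exists_phi_eq (Tribonacci.phi q + x)
  have hq : q ≤ n := by
    by_contra hlt
    have := phi_strictMono.monotone (show n + 1 ≤ q by omega)
    have := (phi_succ_bounds n).1
    omega
  obtain ⟨d, rfl⟩ := Nat.exists_eq_add_of_le hq
  rcases hn with hn | ⟨hn, h2⟩
  · have hd : d ≤ r := by
      by_contra hlt
      have := phi_strictMono (show q + r < q + d by omega)
      omega
    have := h.phi_add hd
    rw [hn, show Tribonacci.phi q' + x = Tribonacci.phi (q' + d) by omega, seq_phi, seq_phi]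
  · have hd : d < r := by
      by_contra hlt
      have := phi_strictMono.monotone (show q + r ≤ q + d by omega)
      omega
    have := h.phi_add hd.le
    rw [hn, show Tribonacci.phi q' + x = Tribonacci.phi (q' + d) + 1 by omega, seq_phi_add_one,
      seq_phi_add_one, h d hd]

/-- The sum of the first `k` Tribonacci numbers. -/
def tribSum (k : ℕ) : ℕ := ∑ j ∈ Finset.range k, trib j

theorem tribSum_zero : tribSum 0 = 0 := rfl

theorem tribSum_succ (k : ℕ) : tribSum (k + 1) = tribSum k + trib k :=
  Finset.sum_range_succ _ _

/-- The halves feed each other: the agreement makes `phi` additive on `trib k + tribSum k`, which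
gives the next recursion step, and the recursion measures the extended agreement. -/
theorem phi_tribSum_and_agree (k : ℕ) :
    tribSum (k + 1) = phi (tribSum k) + 1 ∧ Agree (trib k) 0 (tribSum k) := by
  induction k with
  | zero => exact ⟨by simp [tribSum_succ, tribSum_zero, phi_zero, trib_zero],
      fun n hn => by simp [tribSum_zero] at hn⟩
  | succ k ih =>
    obtain ⟨h1, h2⟩ := ih
    have h3 := h2.phi_add le_rfl
    rw [← trib_succ, phi_zero, Nat.zero_add, Nat.add_zero] at h3
    refine ⟨?_, ?_⟩
    · have h4 := tribSum_succ k
      rw [tribSum_succ (k + 1), h4, Nat.add_comm (tribSum k), h3]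
      omega
    · have := h2.phi (s := tribSum (k + 1)) (by rw [← trib_succ]; omega)
      rwa [← trib_succ, phi_zero] at this

theorem tribSum_succ' (k : ℕ) : tribSum (k + 1) = phi (tribSum k) + 1 :=
  (phi_tribSum_and_agree k).1

theorem two_mul_tribSum (k : ℕ) : 2 * tribSum (k + 1) + 3 = trib (k + 2) + trib k := by
  induction k with
  | zero => rfl
  | succ k ih =>
    have := trib_add_three k
    rw [tribSum_succ (k + 1), show k + 1 + 2 = k + 3 by rfl]
    omega

theorem tribSum_lt (k : ℕ) : tribSum k + 1 ≤ 2 * trib k := by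
  cases k with
  | zero => decide
  | succ k =>
    have h1 := two_mul_tribSum k
    have h2 := trib_succ_le (k + 1)
    have h3 := trib_strictMono (Nat.lt_succ_self k)
    simp only [Nat.succ_eq_add_one] at h3
    rw [show k + 1 + 1 = k + 2 by rfl] at h2
    omega

theorem trib_le_tribSum (k : ℕ) : trib k ≤ tribSum k + 1 := by
  induction k with
  | zero => decide
  | succ k ih => have := trib_succ_le k; rw [tribSum_succ]; omega

theorem phi_iterate_succ (k x : ℕ) : phi^[k + 1] x = phi (phi^[k] x) :=
  Function.iterate_succ_apply' phi k x

theorem phi_iterate_succ_of_eq_a {x : ℕ} (h : seq x = Letter.a) (k : ℕ) :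
    phi^[k] (x + 1) = phi^[k] x + trib k ∧ Agree (phi^[k] x) 0 (trib k) := by
  induction k with
  | zero =>
    refine ⟨rfl, fun n hn => ?_⟩
    obtain rfl : n = 0 := by rw [trib_zero] at hn; omega
    exact h
  | succ k ih =>
    obtain ⟨h1, h2⟩ := ih
    have h3 := h2.phi_add le_rfl
    rw [phi_zero, Nat.zero_add, Nat.add_zero, ← trib_succ] at h3
    simp only [phi_iterate_succ]
    refine ⟨by rw [h1]; omega, ?_⟩
    have := h2.phi (s := trib (k + 1)) (by omega)
    rwa [phi_zero] at this

/-- Whatever letter stands at `x`, each substitution lengthens the forced common prefix by one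
letter beyond its image. -/
theorem agree_phi_iterate_zero (x k : ℕ) : Agree (phi^[k] x) 0 (tribSum k) := by
  induction k with
  | zero => exact fun n hn => by simp [tribSum_zero] at hn
  | succ k ih =>
    have h3 := ih.phi_add le_rfl
    rw [phi_zero, Nat.zero_add, Nat.add_zero] at h3
    have := ih.phi (s := tribSum (k + 1)) (by rw [tribSum_succ']; omega)
    rwa [phi_zero, ← phi_iterate_succ] at this

/-! ### Runs generated by `aa` -/

/-- The start of an occurrence of `aa`. -/
def IsDouble (x : ℕ) : Prop := seq x = Letter.a ∧ seq (x + 1) = Letter.a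

theorem IsDouble.phi_run_end {x : ℕ} (h : IsDouble x) (k : ℕ) :
    phi (phi^[k] x + 2 * trib k + tribSum k) + 1 =
      phi^[k + 1] x + 2 * trib (k + 1) + tribSum (k + 1) := by
  have key : ∀ k, phi^[k] (x + 2) = phi^[k] x + 2 * trib k := fun k => by
    rw [(phi_iterate_succ_of_eq_a h.2 k).1, (phi_iterate_succ_of_eq_a h.1 k).1]
    ring
  have h3 := (agree_phi_iterate_zero (x + 2) k).phi_add le_rfl
  rw [phi_zero, Nat.zero_add, Nat.add_zero, ← phi_iterate_succ, key, key] at h3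
  rw [h3, tribSum_succ']
  omega

/-- The run consists of two copies of T_k and the forced prefix of length `tribSum k` that follows
them. -/
theorem IsDouble.agree_period {x : ℕ} (h : IsDouble x) (k : ℕ) :
    Agree (phi^[k] x) (phi^[k] x + trib k) (trib k + tribSum k) := by
  induction k with
  | zero =>
    intro n hn
    obtain rfl : n = 0 := by rw [trib_zero, tribSum_zero] at hn; omega
    simpa [trib_zero] using h.1.trans h.2.symm
  | succ k ih =>
    have h1 := (phi_iterate_succ_of_eq_a h.1 k).1
    have h2 := (phi_iterate_succ_of_eq_a h.1 (k + 1)).1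
    rw [phi_iterate_succ, h1] at h2
    have h3 := ih.phi_add le_rfl
    have h4 := h.phi_run_end k
    rw [show phi^[k] x + trib k + (trib k + tribSum k) = phi^[k] x + 2 * trib k + tribSum k by ring,
      h2, ← phi_iterate_succ] at h3
    have := ih.phi (s := trib (k + 1) + tribSum (k + 1))
      (by rw [← phi_iterate_succ]; omega)
    rwa [h2, ← phi_iterate_succ] at this

theorem IsDouble.phi_add_trib {x : ℕ} (h : IsDouble x) {k n : ℕ} (h1 : phi^[k] x ≤ n)
    (h2 : n + trib k ≤ phi^[k] x + 2 * trib k + tribSum k) :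
    phi (n + trib k) = phi n + trib (k + 1) := by
  obtain ⟨d, rfl⟩ := Nat.exists_eq_add_of_le h1
  have h3 := (h.agree_period k).phi_add (n := d) (by omega)
  have h4 := (phi_iterate_succ_of_eq_a h.1 k).1
  have h5 := (phi_iterate_succ_of_eq_a h.1 (k + 1)).1
  rw [phi_iterate_succ, h4, phi_iterate_succ] at h5
  rw [show phi^[k] x + d + trib k = phi^[k] x + trib k + d by ring]
  omega

theorem IsDouble.agree {x y : ℕ} (hx : IsDouble x) (hy : IsDouble y) (k : ℕ) :
    Agree (phi^[k] x) (phi^[k] y) (2 * trib k + tribSum k) := by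
  induction k with
  | zero =>
    intro n hn
    have : n = 0 ∨ n = 1 := by rw [trib_zero, tribSum_zero] at hn; omega
    rcases this with rfl | rfl
    · exact hx.1.trans hy.1.symm
    · exact hx.2.trans hy.2.symm
  | succ k ih =>
    have h4 := hx.phi_run_end k
    have := ih.phi (s := 2 * trib (k + 1) + tribSum (k + 1))
      (by rw [← phi_iterate_succ, ← Nat.add_assoc (phi^[k] x)]; omega)
    rwa [← phi_iterate_succ, ← phi_iterate_succ] at this

/-! ### Desubstitution of repetitions -/

/-- A repetition `[i, j)` of period `p` and length at least `3 * p - 1` is contained in one of the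
runs generated by the occurrences of `aa`. -/
theorem exists_run_of_period (m : ℕ) : ∀ i j p : ℕ, 1 ≤ p → i + 3 * p ≤ j + 1 → j ≤ trib m →
    (∀ n, i ≤ n → n + p < j → seq n = seq (n + p)) →
    ∃ k x, IsDouble x ∧ k + 4 ≤ m ∧ p = trib k ∧ phi^[k] x ≤ i ∧
      j ≤ phi^[k] x + 2 * trib k + tribSum k := by
  induction m with
  | zero =>
    intro i j p hp hlen hj
    rw [trib_zero] at hj
    omega
  | succ m ih =>
    intro i j p hp hlen hj hper
    obtain rfl | hp2 : p = 1 ∨ 2 ≤ p := by omega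
    · have h0 := hper i le_rfl (by omega)
      have ha : seq i = Letter.a := by
        by_contra hne
        exact hne (h0.trans (seq_succ_of_ne_a hne))
      have hj2 : j = i + 2 := by
        by_contra hne
        have h1 := hper (i + 1) (by omega) (by omega)
        exact not_seq_cube ha (h0 ▸ ha) (h1 ▸ h0 ▸ ha)
      refine ⟨0, i, ⟨ha, h0 ▸ ha⟩, ?_, trib_zero.symm, le_rfl, ?_⟩
      -- T_3 has length 7 and contains no `aa`: the first one starts at position 6.
      · by_contra hm
        have h7 : j ≤ 7 :=
          hj.trans ((trib_strictMono.monotone (show m + 1 ≤ 3 by omega)).trans (by decide))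
        have h5 : i ≤ 5 := by omega
        interval_cases i
        · cases (show Letter.a = Letter.b from h0)
        · cases (show Letter.b = Letter.a from h0)
        · cases (show Letter.a = Letter.c from h0)
        · cases (show Letter.c = Letter.a from h0)
        · cases (show Letter.a = Letter.b from h0)
        · cases (show Letter.b = Letter.a from h0)
      · simp [trib_zero, tribSum_zero, hj2]
    · obtain ⟨i', hi⟩ := exists_phi_eq i
      have hi1 : phi i' ≤ i := by omega
      have hi2 : i ≤ phi i' + 1 := by omega
      have hsi := hper i le_rfl (by omega)
      -- A shift by the period sends block starts to block starts: an `a` goes to an `a`, and a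
      -- second letter `b` or `c` to another second letter.
      obtain ⟨i2, hi2'⟩ : ∃ n, phi i' + p = phi n := by
        rcases hi with rfl | ⟨rfl, h2⟩
        · exact exists_phi_eq_of_seq_eq_a (hsi ▸ seq_phi i')
        · have hne : seq (phi i' + 1) ≠ Letter.a := by
            rw [seq_phi_add_one]
            intro hc
            rw [phi_succ_of_eq_c (sndLetter_injective (hc.trans rfl))] at h2
            omega
          obtain ⟨n, hn, -⟩ := exists_phi_add_one_eq_of_seq_ne_a (hsi ▸ hne)
          exact ⟨n, by omega⟩
      have hlt : i' < i2 := phi_strictMono.lt_iff_lt.1 (by omega)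
      obtain ⟨p', rfl⟩ := Nat.exists_eq_add_of_le hlt.le
      have hp' : 1 ≤ p' := by omega
      -- Blocks before `e` show their first two letters before `j`, enough to recover the preimage
      -- letter; at most the uninformative initial `a` of block `e` is left over.
      obtain ⟨e, he, hmin⟩ : ∃ e, j ≤ phi e + 1 ∧ ∀ n < e, phi n + 1 < j := by
        have hex : ∃ e, j ≤ phi e + 1 := ⟨j, by have := phi_strictMono.le_apply (x := j); omega⟩
        exact ⟨Nat.find hex, Nat.find_spec hex, fun n hn => by
          have := Nat.find_min hex hn
          omega⟩
      have hshift : ∀ d, i' + d + p' ≤ e → phi (i' + d) + p = phi (i' + d + p') ∧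
          Agree i' (i' + p') d := by
        intro d
        induction d with
        | zero => exact fun _ => ⟨hi2', fun n hn => by omega⟩
        | succ d ihd =>
          intro hd
          obtain ⟨h1, h2⟩ := ihd (by omega)
          have h3 := hmin (i' + d + p') (by omega)
          have h4 : i ≤ phi (i' + d) + 1 := by
            have := phi_strictMono.monotone (show i' ≤ i' + d by omega)
            omega
          have h5 := hper (phi (i' + d) + 1) h4 (by omega)
          rw [show phi (i' + d) + 1 + p = phi (i' + d + p') + 1 by omega, seq_phi_add_one,
            seq_phi_add_one] at h5
          have h6 := sndLetter_injective h5
          refine ⟨?_, fun n hn => ?_⟩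
          · rw [show i' + (d + 1) = i' + d + 1 by ring,
              show i' + d + 1 + p' = i' + d + p' + 1 by ring, phi_succ, phi_succ, ← h6]
            omega
          · rcases Nat.lt_succ_iff_lt_or_eq.1 hn with h | rfl
            · exact h2 n h
            · rw [h6, show i' + n + p' = i' + p' + n by ring]
      have hshift' : ∀ n, i' ≤ n → n + p' ≤ e → phi (n + p') = phi n + p := by
        intro n h1 h2
        obtain ⟨d, rfl⟩ := Nat.exists_eq_add_of_le h1
        exact (hshift d h2).1.symm
      have he1 : i' + p' ≤ e := by
        by_contra hlt
        have := phi_strictMono (show e < i' + p' by omega)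
        omega
      have he2 : i' + 2 * p' ≤ e := by
        by_contra hlt
        have h1 := hshift' (e - p') (by omega) (by omega)
        rw [Nat.sub_add_cancel (by omega)] at h1
        have := phi_strictMono (show e - p' < i' + p' by omega)
        omega
      -- The bound 3p - 1 survives desubstitution: a preimage two letters short would cost at least
      -- three letters of image, by `phi_add_two`.
      have he3 : i' + 3 * p' ≤ e + 1 := by
        by_contra hlt
        have h1 := hshift' (e - p') (by omega) (by omega)
        have h2 := hshift' (e - p' - p') (by omega) (by omega)
        rw [Nat.sub_add_cancel (by omega)] at h1 h2
        have h3 := phi_strictMono.monotone (show e - p' - p' + 2 ≤ i' + p' by omega)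
        have h4 := phi_add_two (e - p' - p')
        omega
      have hem : e ≤ trib m := by
        by_contra hlt
        have := hmin (trib m) (by omega)
        rw [← trib_succ] at this
        omega
      obtain ⟨k, x, hx, hkm, rfl, hq, hend⟩ := ih i' e p' hp' he3 hem (fun n hn hne => by
        obtain ⟨d, rfl⟩ := Nat.exists_eq_add_of_le hn
        have := (hshift (d + 1) (by omega)).2 d (by omega)
        rw [this, show i' + d + p' = i' + p' + d by ring])
      refine ⟨k + 1, x, hx, by omega, ?_, ?_, ?_⟩
      · have := hx.phi_add_trib hq (by omega)
        omega
      · rw [phi_iterate_succ]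
        exact (phi_strictMono.monotone hq).trans hi1
      · rw [← hx.phi_run_end]
        have := phi_strictMono.monotone hend
        omega

/-! ### Factors and cubes as windows -/

/-- The factor of length `n` at position `i` of the Tribonacci sequence. -/
def window (i n : ℕ) : List Letter := (List.range n).map fun x => seq (i + x)

theorem window_length (i n : ℕ) : (window i n).length = n := by simp [window]

theorem window_eq_iff {i j n : ℕ} : window i n = window j n ↔ Agree i j n := by
  simp [window, Agree]

theorem window_add (i m n : ℕ) : window i (m + n) = window i m ++ window (i + m) n := by
  simp [window, List.range_add, Nat.add_assoc]

theorem prefixWord_eq_window (n : ℕ) : prefixWord n = window 0 n := by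
  simp [prefixWord, window]

theorem isInfix_prefixWord_iff {u : List Letter} {N : ℕ} :
    u <:+: prefixWord N ↔ ∃ i, i + u.length ≤ N ∧ u = window i u.length := by
  constructor
  · rintro ⟨s, r, h⟩
    have hlen := congrArg List.length h
    simp only [List.length_append, prefixWord_length] at hlen
    refine ⟨s.length, by omega, ?_⟩
    rw [prefixWord_eq_window, ← hlen, window_add, window_add] at h
    have h1 := List.append_inj_left h (by simp [window_length])
    have h2 := List.append_inj_right h1 (by simp [window_length])
    simpa using h2
  · rintro ⟨i, hi, hu⟩
    rw [hu]
    refine ⟨window 0 i, window (i + u.length) (N - (i + u.length)), ?_⟩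
    rw [prefixWord_eq_window, show N = i + u.length + (N - (i + u.length)) by omega, window_add,
      window_add]
    simp

theorem isCube_window {i p : ℕ} (hp : 0 < p) (h : Agree i (i + p) (2 * p)) :
    IsCube (window i (3 * p)) := by
  refine ⟨window i p, fun h0 => ?_, ?_⟩
  · have := window_length i p
    rw [h0] at this
    simp at this
    omega
  · rw [show 3 * p = p + p + p by ring, window_add, window_add]
    have h1 : window i p = window (i + p) p := window_eq_iff.2 fun n hn => h n (by omega)
    have h2 : window (i + p) p = window (i + (p + p)) p := window_eq_iff.2 fun n hn => by
      have := h (p + n) (by omega)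
      rw [← Nat.add_assoc] at this
      rw [this]
      congr 1
      ring
    rw [← h2, ← h1]

theorem IsCube.exists_agree {i n : ℕ} (h : IsCube (window i n)) :
    ∃ p, 0 < p ∧ n = 3 * p ∧ Agree i (i + p) (2 * p) := by
  obtain ⟨w, hw, he⟩ := h
  have hlen := congrArg List.length he
  simp only [window_length, List.length_append] at hlen
  refine ⟨w.length, List.length_pos_iff.2 hw, by omega, ?_⟩
  rw [hlen] at he
  have h1 := he
  rw [window_add] at h1
  have h3 := List.append_inj_left h1 (by simp [window_length])
  have h2 := he
  rw [Nat.add_assoc, window_add, List.append_assoc] at h2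
  have h4 := List.append_inj_right h2 (by simp [window_length])
  rw [two_mul]
  exact window_eq_iff.1 (h3.trans h4.symm)

/-! ### Counting the cubes -/

/-- The number of distinct cubes of period `trib k`. -/
def cubeCount (k : ℕ) : ℕ := tribSum k + 1 - trib k

theorem isDouble_six : IsDouble 6 := ⟨rfl, rfl⟩

/-- The slack of 2 is what the induction preserves: two letters have an image of length at least 3,
and the longer run uses up one. -/
theorem run_end_le (k : ℕ) : phi^[k] 6 + 2 * trib k + tribSum k + 2 ≤ trib (k + 4) := by
  induction k with
  | zero => decide
  | succ k ih =>
    rw [← isDouble_six.phi_run_end, show k + 1 + 4 = k + 4 + 1 by ring, trib_succ (k + 4)]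
    have h1 := phi_strictMono.monotone ih
    have h2 := phi_add_two (phi^[k] 6 + 2 * trib k + tribSum k)
    omega

/-- The cube of period `trib k` at offset `d` in the first run of that period. -/
def runCube (x : Σ _ : ℕ, ℕ) : List Letter := window (phi^[x.1] 6 + x.2) (3 * trib x.1)

theorem cubesIn_prefixWord_trib (m : ℕ) :
    cubesIn (prefixWord (trib m)) =
      runCube '' ((Finset.range (m - 3)).sigma fun k => Finset.range (cubeCount k)) := by
  ext u
  simp only [cubesIn, Set.mem_ofPred_eq, Set.mem_image, Finset.mem_coe, Finset.mem_sigma,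
    Finset.mem_range, isInfix_prefixWord_iff]
  constructor
  · rintro ⟨hc, i, hi, hu⟩
    rw [hu] at hc
    obtain ⟨p, hp, hup, hag⟩ := hc.exists_agree
    rw [hup] at hu hi
    obtain ⟨k, x, hx, hkm, rfl, h1, h2⟩ := exists_run_of_period m i (i + 3 * p) p hp (by omega) hi
      (fun n hn hnp => by
        obtain ⟨d, rfl⟩ := Nat.exists_eq_add_of_le hn
        rw [hag d (by omega)]
        congr 1
        ring)
    obtain ⟨d, rfl⟩ := Nat.exists_eq_add_of_le h1
    refine ⟨⟨k, d⟩, ⟨by dsimp only; omega, by dsimp only [cubeCount]; omega⟩, ?_⟩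
    rw [hu, runCube]
    dsimp only
    -- Any run of level `k` is a copy of the first, so the cube reappears there at the same offset.
    refine window_eq_iff.2 fun n hn => ?_
    rw [Nat.add_assoc, Nat.add_assoc]
    exact isDouble_six.agree hx k (d + n) (by omega)
  · rintro ⟨⟨k, d⟩, ⟨hk, hd⟩, rfl⟩
    dsimp only [cubeCount] at hk hd
    refine ⟨isCube_window (trib_pos k) fun n hn => ?_, phi^[k] 6 + d, ?_, ?_⟩
    · have := isDouble_six.agree_period k (d + n) (by dsimp only at hn; omega)
      dsimp only
      rw [Nat.add_assoc, this]
      congr 1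
      ring
    · rw [runCube, window_length]
      have h1 := run_end_le k
      have h2 := trib_strictMono.monotone (show k + 4 ≤ m by omega)
      dsimp only
      omega
    · rw [runCube, window_length]

theorem window_injOn_run {k d d' : ℕ} (hlt : d < d') (hd : d' < cubeCount k) :
    window (phi^[k] 6 + d) (3 * trib k) ≠ window (phi^[k] 6 + d') (3 * trib k) := by
  intro h
  have hag := window_eq_iff.1 h
  rw [cubeCount] at hd
  have hb := tribSum_lt k
  have hend := run_end_le k
  obtain ⟨δ, rfl⟩ := Nat.exists_eq_add_of_le hlt.le
  -- Equal cubes at distance `δ < trib k` overlap in a repetition of period `δ` and length `δ + 3 *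
  -- trib k`. Being in a run of period `δ = trib l`, it is shorter than `4 * δ`, which is absurd.
  obtain ⟨l, x, -, -, hl, h1, h2⟩ := exists_run_of_period (k + 4) (phi^[k] 6 + d)
    (phi^[k] 6 + (d + δ) + 3 * trib k) δ (by omega) (by omega) (by omega)
    (fun n hn hnp => by
      obtain ⟨e, rfl⟩ := Nat.exists_eq_add_of_le hn
      rw [hag e (by omega)]
      congr 1
      ring)
  have h3 := tribSum_lt l
  omega

theorem runCube_injOn (m : ℕ) : Set.InjOn runCube
    ((Finset.range (m - 3)).sigma fun k => Finset.range (cubeCount k) : Finset (Σ _ : ℕ, ℕ)) := by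
  rintro ⟨k, d⟩ h ⟨k', d'⟩ h' he
  simp only [Finset.mem_coe, Finset.mem_sigma, Finset.mem_range] at h h'
  have hlen := congrArg List.length he
  simp only [runCube, window_length] at hlen
  obtain rfl : k = k' := trib_strictMono.injective (by omega)
  simp only [runCube] at he
  rcases lt_trichotomy d d' with hlt | rfl | hlt
  · exact absurd he (window_injOn_run hlt h'.2)
  · rfl
  · exact absurd he.symm (window_injOn_run hlt h.2)

theorem B_trib (m : ℕ) : B (trib m) = ∑ k ∈ Finset.range (m - 3), cubeCount k := by
  rw [B, cubesIn_prefixWord_trib, (runCube_injOn m).ncard_image, Set.ncard_coe_finset,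
    Finset.card_sigma]
  simp

theorem two_mul_sum_cubeCount (n : ℕ) :
    2 * ∑ k ∈ Finset.range (n + 4), cubeCount k + (n + 4) = trib (n + 2) + trib (n + 1) := by
  induction n with
  | zero => decide
  | succ n ih =>
    rw [show n + 1 + 4 = n + 4 + 1 by ring, Finset.sum_range_succ, cubeCount]
    have h1 := two_mul_tribSum (n + 3)
    -- This makes the truncated subtraction in `cubeCount` exact.
    have h2 := trib_le_tribSum (n + 4)
    have h3 := trib_add_three (n + 2)
    have h4 := trib_add_three (n + 1)
    rw [show n + 3 + 1 = n + 4 by rfl, show n + 3 + 2 = n + 5 by rfl] at h1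
    rw [show n + 2 + 3 = n + 5 by rfl, show n + 2 + 2 = n + 4 by rfl,
      show n + 2 + 1 = n + 3 by rfl] at h3
    rw [show n + 1 + 3 = n + 4 by rfl, show n + 1 + 2 = n + 3 by rfl,
      show n + 1 + 1 = n + 2 by rfl] at h4
    rw [show n + 1 + 2 = n + 3 by rfl, show n + 1 + 1 = n + 2 by rfl]
    omega

theorem B_trib_eq_zero {m : ℕ} (hm : m ≤ 6) : B (trib m) = 0 := by
  rw [B_trib]
  interval_cases m <;> decide

theorem B_zero : B 0 = 0 := by
  rw [B, Set.ncard_eq_zero (cubesIn_finite _), Set.eq_empty_iff_forall_notMem]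
  rintro u ⟨⟨w, hw, rfl⟩, h⟩
  have h1 := h.length_le
  have h2 := List.length_pos_iff.2 hw
  simp only [List.length_append, prefixWord_length] at h1
  omega

end Tribonacci

theorem mainTheorem4 :
    (∀ m : ℤ, -2 ≤ m → m ≤ 6 → Tribonacci.B (Tribonacci.t m) = 0) ∧
    (∀ m : ℤ, 7 ≤ m →
      (Tribonacci.B (Tribonacci.t m) : ℚ) =
        ((Tribonacci.t (m - 5) : ℚ) + (Tribonacci.t (m - 6) : ℚ) - (m : ℚ) + 3) / 2) := by
  refine ⟨fun m h1 h2 => ?_, fun m hm => ?_⟩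
  · obtain rfl | rfl | h0 : m = -2 ∨ m = -1 ∨ 0 ≤ m := by omega
    · exact Tribonacci.B_zero
    -- T_{-1} and T_0 both have length 1.
    · exact Tribonacci.B_trib_eq_zero (m := 0) (by omega)
    · lift m to ℕ using h0
      exact Tribonacci.B_trib_eq_zero (by omega)
  · obtain ⟨n, rfl⟩ : ∃ n : ℕ, m = ((n + 7 : ℕ) : ℤ) := ⟨(m - 7).toNat, by omega⟩
    rw [show ((n + 7 : ℕ) : ℤ) - 5 = ((n + 2 : ℕ) : ℤ) by push_cast; ring,
      show ((n + 7 : ℕ) : ℤ) - 6 = ((n + 1 : ℕ) : ℤ) by push_cast; ring]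
    change (Tribonacci.B (Tribonacci.trib (n + 7)) : ℚ) =
      ((Tribonacci.trib (n + 2) : ℚ) + (Tribonacci.trib (n + 1) : ℚ) - _ + 3) / 2
    have h := Tribonacci.two_mul_sum_cubeCount n
    rw [show n + 4 = n + 7 - 3 by omega, ← Tribonacci.B_trib] at h
    have h' : (n + 7 - 3 : ℕ) = n + 4 := by omega
    rw [h'] at h
    have hq : (2 * (Tribonacci.B (Tribonacci.trib (n + 7)) : ℚ) + (n + 4)) =
        Tribonacci.trib (n + 2) + Tribonacci.trib (n + 1) := by exact_mod_cast h
    push_cast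
    linarith
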